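/- Let $\mathbb D=\{z\in\mathbb C:|z|<1\}$, $\mathbb T=\partial\mathbb D$ and $\mathbb Z_+=\{0,1,2,\dots\}$. Let $H^\infty$ be the space of bounded holomorphic functions $f$ on $\mathbb D$, with norm $\|f\|_\infty=\sup_{z\in\mathbb D}|f(z)|$; each $f\in H^\infty$ is identified with its boundary trace on $\mathbb T$, i.e. its nontangential limit, which exists almost everywhere. For an integrable function $f$ on $\mathbb T$ put $$\widehat f(k)=\frac1{2\pi}\int_{\mathbb T}\overline\zeta^{\,k}f(\zeta)\,|d\zeta|\quad(k\in\mathbb Z),\qquad \operatorname{spec}f=\{k\in\mathbb Z:\widehat f(k)\neq0\}.$$ For $\Lambda\subset\mathbb Z_+$ let $H^\infty(\Lambda)=\{f\in H^\infty:\operatorname{spec}f\subset\Lambda\}$, with norm $\|\cdot\|_\infty$, and let $\operatorname{ball}(H^\infty(\Lambda))=\{f\in H^\infty(\Lambda):\|f\|_\infty\le1\}$. **Theorem 2.1.** Let $\Lambda\subset\mathbb Z_+$ be a set such that $\mathbb Z_+\setminus\Lambda$ is finite. Suppose that $f\in H^\infty(\Lambda)$ and $\|f\|_\infty=1$. Then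 $f$ is an extreme point of $\operatorname{ball}(H^\infty(\Lambda))$ if and only if $$\int_{\mathbb T}\log\bigl(1-|f(\zeta)|\bigr)\,|d\zeta|=-\infty,$$ where $\log 0=-\infty$. -/

import Mathlib

open Complex MeasureTheory Filter Topology
open scoped BoundedContinuousFunction ComplexConjugate ENNReal

noncomputable section

namespace HardySpectrum

/-- The open unit disk `{z : ℂ | |z| < 1}`. -/
abbrev Disk : Type := Complex.UnitDisc

/-- The Hardy space `H^∞` of bounded holomorphic functions on the unit disk, as a subspace of the
bounded continuous functions on the disk. Its norm is the supremum norm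
`‖f‖_∞ = sup {|f z| : z ∈ 𝔻}`. -/
def HInfty : Submodule ℂ (Disk →ᵇ ℂ) where
  carrier := {f | ∃ F : ℂ → ℂ, DifferentiableOn ℂ F (Metric.ball 0 1) ∧ ∀ z : Disk, f z = F z}
  zero_mem' := ⟨0, differentiableOn_const 0, fun _ => rfl⟩
  add_mem' := by
    rintro f g ⟨F, hF, hfF⟩ ⟨G, hG, hgG⟩
    exact ⟨F + G, hF.add hG, fun z => by simp [hfF, hgG]⟩
  smul_mem' := by
    rintro c f ⟨F, hF, hfF⟩
    exact ⟨c • F, hF.const_smul c, fun z => by simp [hfF]⟩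

/-- The nontangential approach region (Stolz region) of aperture `a` at the point `ζ` of the unit
circle: all `z` in the disk with `|z - ζ| < a (1 - |z|)`. -/
def stolzRegion (a : ℝ) (ζ : Circle) : Set Disk :=
  {z | ‖(z : ℂ) - (ζ : ℂ)‖ < a * (1 - ‖(z : ℂ)‖)}

/-- `f` has nontangential limit `w` at `ζ`: for every aperture `a > 1`, `f z → w` as `z → ζ` inside
the Stolz region of aperture `a`. -/
def HasNontangentialLimit (f : Disk → ℂ) (ζ : Circle) (w : ℂ) : Prop :=
  ∀ a : ℝ, 1 < a →
    Tendsto f (comap (fun z : Disk => (z : ℂ)) (𝓝 (ζ : ℂ)) ⊓ 𝓟 (stolzRegion a ζ)) (𝓝 w)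

open Classical in
/-- The boundary trace of `f` on the unit circle: its nontangential limit wherever this exists (for
`f ∈ H^∞` this is almost everywhere), and `0` elsewhere. -/
def boundaryTrace (f : Disk → ℂ) (ζ : Circle) : ℂ :=
  if h : ∃ w, HasNontangentialLimit f ζ w then h.choose else 0

/-- The `k`-th Fourier coefficient `(1/2π) ∫_𝕋 conj(ζ)^k φ(ζ) |dζ|` of a function on the circle. -/
def fourierCoefficient (φ : Circle → ℂ) (k : ℤ) : ℂ :=
  (1 / (2 * Real.pi) : ℂ) *
    ∫ θ in (0 : ℝ)..(2 * Real.pi), (conj (Circle.exp θ : ℂ)) ^ k * φ (Circle.exp θ)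

/-- The spectrum of a function on the circle: the set of all `k` with nonzero `k`-th Fourier
coefficient. -/
def spec (φ : Circle → ℂ) : Set ℤ := {k | fourierCoefficient φ k ≠ 0}

/-- `H^∞(Λ)`: all `f ∈ H^∞` whose (boundary trace's) spectrum is contained in `Λ`. -/
def HInftyOf (Λ : Set ℕ) : Set (Disk →ᵇ ℂ) :=
  {f | f ∈ HInfty ∧ spec (boundaryTrace f) ⊆ (fun n : ℕ => (n : ℤ)) '' Λ}

/-- The closed unit ball of `H^∞(Λ)` in the norm `‖·‖_∞`. -/
def unitBall (Λ : Set ℕ) : Set (Disk →ᵇ ℂ) := {f | f ∈ HInftyOf Λ ∧ ‖f‖ ≤ 1}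

/-- The integral `∫_𝕋 u(ζ) |dζ|` against arc length of an extended-real-valued function `u` on the
circle, as the integral of the positive part minus that of the negative part (meaningful when one of
the two is finite). -/
def circleIntegralEReal (u : Circle → EReal) : EReal :=
  ((∫⁻ θ in Set.Ioc (0 : ℝ) (2 * Real.pi), (u (Circle.exp θ)).toENNReal : ℝ≥0∞) : EReal) -
    ((∫⁻ θ in Set.Ioc (0 : ℝ) (2 * Real.pi), (-u (Circle.exp θ)).toENNReal : ℝ≥0∞) : EReal)

/-- `∫_𝕋 log(1 - |φ(ζ)|) |dζ|` as an extended real number, for `|φ| ≤ 1` almost everywhere. The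
extended logarithm satisfies `log 0 = -∞`. -/
def logIntegral (φ : Circle → ℂ) : EReal :=
  circleIntegralEReal fun ζ => ENNReal.log (ENNReal.ofReal (1 - ‖φ ζ‖))

end HardySpectrum

end

/-!
Write `f*` for the boundary trace of `f ∈ H^∞`. The condition on `spec f` amounts to the vanishing
of finitely many Fourier coefficients of `f*`, since the coefficients of negative index vanish for
every `f ∈ H^∞` (`mem_HInftyOf_iff`).

*If `∫ log (1 - |f*|) = -∞`, then `f` is extreme.* Let `f = a g + b k` with `g`, `k` in the ball and
`φ = (g - k) / 2`. The parallelogram identity gives `4 a b |φ|² ≤ 1 - |f|²`, hence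
`2 a b |φ*|² ≤ 1 - |f*|`, so that `∫ log |φ*| = -∞`. A nonzero function in `H^∞` has log-integrable
trace (`lintegral_negLog_boundaryTrace_ne_top`), so `φ = 0`.

*If `∫ log (1 - |f*|) > -∞`, then `f` is not extreme.* Let `g` be the outer function with boundary
modulus `1 - |f*|`. Then `|f| + |g| ≤ 1` on the disk (`exists_outer`); comparing Poisson integrals
proves this without boundary values of `g`. With `N` forbidden frequencies, the polynomials
`p` of degree at most `N` form a space of dimension `N + 1`, so some `p ≠ 0` makes the forbidden
coefficients of `g p` vanish. After scaling, `|p| ≤ 1` on the disk and `f` is the midpoint of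
`f + g p` and `f - g p`, both in the ball.

Both parts use Fatou's theorem that nontangential limits exist almost everywhere
(`ae_exists_hasNontangentialLimit`). A primitive `G` of `f` is Lipschitz, so its boundary values are
differentiable almost everywhere, and at a point of differentiability `G'` has a nontangential
limit: `G' z` is the average of `G` against a kernel of size at most `2 P_z(ζ) / |ζ - z|`, where
`P_z` is the Poisson kernel.
-/

open Complex MeasureTheory Filter Topology
open scoped BoundedContinuousFunction ComplexConjugate ENNReal

namespace HardySpectrum

open Metric

/-! ### Poisson kernel and derivatives -/

theorem norm_circleAverage_le {F : ℂ → ℂ} {b : ℂ → ℝ} (hb : CircleIntegrable b 0 1)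
    (h : ∀ᵐ θ ∂(volume.restrict (Set.Ioc (0 : ℝ) (2 * Real.pi))),
      ‖F (circleMap 0 1 θ)‖ ≤ b (circleMap 0 1 θ)) :
    ‖Real.circleAverage F 0 1‖ ≤ Real.circleAverage b 0 1 := by
  rw [Real.circleAverage_def, Real.circleAverage_def, norm_smul, smul_eq_mul,
    Real.norm_of_nonneg (by positivity)]
  gcongr
  refine intervalIntegral.norm_integral_le_of_norm_le Real.two_pi_pos.le ?_ hb
  exact (ae_restrict_iff' measurableSet_Ioc).1 h

theorem circleIntegrable_poissonKernel {z : ℂ} (hz : z ∈ ball (0 : ℂ) 1) :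
    CircleIntegrable (poissonKernel 0 z) 0 1 := by
  refine ContinuousOn.circleIntegrable zero_le_one ?_
  have h : ContinuousOn (Complex.re ∘ herglotzRieszKernel 0 z) (sphere (0 : ℂ) |1|) :=
    Complex.continuous_re.comp_continuousOn (continuousOn_herglotzRieszKernel_sphere hz)
  rw [poissonKernel_eq_re_herglotzRieszKernel]
  simpa using h

theorem circleAverage_poissonKernel {z : ℂ} (hz : z ∈ ball (0 : ℂ) 1) :
    Real.circleAverage (poissonKernel 0 z) 0 1 = 1 := by
  have h := (diffContOnCl_const (c := (1 : ℂ)) (s := ball (0 : ℂ) 1)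
    (𝕜 := ℂ)).circleAverage_poissonKernel_smul hz
  have h2 := Complex.ofRealCLM.circleAverage_comp_comm (circleIntegrable_poissonKernel hz)
  apply Complex.ofReal_injective
  rw [Complex.ofReal_one, ← h]
  refine h2.symm.trans ?_
  congr 1
  ext w
  simp

theorem poissonKernel_nonneg {z w : ℂ} (hz : ‖z‖ < 1) (hw : ‖w‖ = 1) : 0 ≤ poissonKernel 0 z w := by
  simp only [poissonKernel_def, sub_zero, hw]
  have := norm_nonneg z
  apply div_nonneg (by nlinarith) (by positivity)

/-- The kernel representing the derivative at `z` of a function holomorphic in the disk by its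
boundary values. The first term is Cauchy's kernel; the second is holomorphic in the closed disk and
vanishes at `0`, so it does not affect the average, but it lowers the order of the singularity
as `z` tends to the circle. -/
noncomputable def derivKernel (z ζ : ℂ) : ℂ :=
  ζ / (ζ - z) ^ 2 - ζ * conj z ^ 2 / (1 - conj z * ζ) ^ 2

theorem one_sub_conj_mul_ne_zero {z ζ : ℂ} (hz : ‖z‖ < 1) (hζ : ‖ζ‖ ≤ 1) :
    1 - conj z * ζ ≠ 0 := by
  intro h
  have h1 : ‖conj z * ζ‖ = 1 := by rw [← sub_eq_zero.1 h]; simp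
  rw [norm_mul, RCLike.norm_conj] at h1
  nlinarith [norm_nonneg z, norm_nonneg ζ]

theorem sub_ne_zero_of_norm {z ζ : ℂ} (hz : ‖z‖ < 1) (hζ : ‖ζ‖ = 1) : ζ - z ≠ 0 := by
  intro h
  rw [sub_eq_zero.1 h] at hζ
  linarith

/-- The gain from the subtracted term: Cauchy's kernel alone is only bounded by
`1 / |ζ - z|²`, which is not small enough for a differentiability argument at the boundary. -/
theorem norm_derivKernel_le {z ζ : ℂ} (hz : ‖z‖ < 1) (hζ : ‖ζ‖ = 1) :
    ‖derivKernel z ζ‖ ≤ 2 * poissonKernel 0 z ζ / ‖ζ - z‖ := by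
  have h1 := sub_ne_zero_of_norm hz hζ
  have h2 := one_sub_conj_mul_ne_zero hz hζ.le
  have h3 : ‖1 - conj z * ζ‖ = ‖ζ - z‖ := by
    have : 1 - conj z * ζ = ζ * conj (ζ - z) := by
      have : ζ * conj ζ = 1 := by rw [Complex.mul_conj, Complex.normSq_eq_norm_sq, hζ]; simp
      rw [map_sub, mul_sub, this]; ring
    rw [this, norm_mul, RCLike.norm_conj, hζ, one_mul]
  have h4 : derivKernel z ζ = ζ * ((1 - conj z * ζ) - conj z * (ζ - z)) * (1 - conj z * z)
      / ((ζ - z) ^ 2 * (1 - conj z * ζ) ^ 2) := by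
    rw [derivKernel, div_sub_div _ _ (pow_ne_zero 2 h1) (pow_ne_zero 2 h2)]
    congr 1; ring
  have h5 : ‖1 - conj z * z‖ = 1 - ‖z‖ ^ 2 := by
    rw [← Complex.normSq_eq_conj_mul_self, Complex.normSq_eq_norm_sq]
    rw [← Complex.ofReal_one, ← Complex.ofReal_sub, Complex.norm_real, Real.norm_of_nonneg]
    nlinarith [norm_nonneg z]
  have h6 : ‖(1 - conj z * ζ) - conj z * (ζ - z)‖ ≤ 2 * ‖ζ - z‖ := by
    refine (norm_sub_le _ _).trans ?_
    rw [h3, norm_mul, RCLike.norm_conj]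
    nlinarith [norm_nonneg (ζ - z)]
  have h7 : 0 < ‖ζ - z‖ := norm_pos_iff.2 h1
  have h8 : 0 ≤ 1 - ‖z‖ ^ 2 := by nlinarith [norm_nonneg z]
  rw [h4, norm_div, norm_mul, norm_mul, norm_mul, norm_pow, norm_pow, h3, h5, hζ, poissonKernel_def]
  simp only [sub_zero, hζ, one_mul, one_pow]
  calc _ ≤ (2 * ‖ζ - z‖) * (1 - ‖z‖ ^ 2) / (‖ζ - z‖ ^ 2 * ‖ζ - z‖ ^ 2) := by gcongr
    _ = _ := by field_simp

theorem deriv_eq_circleAverage {H : ℂ → ℂ} (hH : DiffContOnCl ℂ H (ball 0 1)) {z : ℂ}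
    (hz : z ∈ ball (0 : ℂ) 1) :
    deriv H z = Real.circleAverage (fun ζ => derivKernel z ζ • H ζ) 0 1 := by
  have hz1 : ‖z‖ < 1 := by simpa using hz
  have hc : ContinuousOn H (sphere 0 1) :=
    hH.2.mono (sphere_subset_closedBall.trans_eq (closure_ball 0 one_ne_zero).symm)
  have hint : CircleIntegrable H 0 1 := hc.circleIntegrable zero_le_one
  have hI1 : CircleIntegrable (fun ζ => (2 * ζ / (ζ - z) ^ 2) • H ζ) 0 1 := by
    have h : ContinuousOn (fun ζ => 2 * ζ / (ζ - z) ^ 2) (sphere (0 : ℂ) 1) := by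
      refine ContinuousOn.div (by fun_prop) (by fun_prop) fun w hw => ?_
      exact pow_ne_zero _ (sub_ne_zero_of_norm hz1 (by simpa using hw))
    exact (h.smul hc).circleIntegrable zero_le_one
  have key : ∀ w ∈ ball (0 : ℂ) 1,
      Real.circleAverage (fun ζ ↦ herglotzRieszKernel 0 w ζ • H ζ) 0 1 = 2 * H w - H 0 := by
    intro w hw
    have hw1 : ‖w‖ < 1 := by simpa using hw
    have e1 := DiffContOnCl.circleAverage_smul_div (R := 1) (c := 0) (f := H) (by simpa using hH)
      (w := w) (by simpa using hw)
    have e2 := DiffContOnCl.circleAverage (R := 1) (c := 0) (f := H) (by simpa using hH)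
    rw [← e1, ← e2, ← smul_eq_mul (2 : ℂ), ← Real.circleAverage_fun_smul,
      ← Real.circleAverage_fun_sub]
    · refine Real.circleAverage_congr_sphere ?_
      intro ζ hζ
      have := sub_ne_zero_of_norm hw1 (ζ := ζ) (by simpa using hζ)
      simp only [herglotzRieszKernel_def, sub_zero, smul_eq_mul]
      field_simp; ring
    · have h : ContinuousOn (fun ζ => (ζ - 0) / (ζ - w)) (sphere (0 : ℂ) 1) := by
        refine ContinuousOn.div (by fun_prop) (by fun_prop) fun ζ hζ => ?_
        exact sub_ne_zero_of_norm hw1 (by simpa using hζ)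
      exact ((h.smul hc).const_smul (2 : ℂ)).circleIntegrable zero_le_one
    · exact hint
  -- Differentiating `key` in the pole turns Cauchy's formula for `H` into one for its derivative.
  have hd : HasDerivAt H (deriv H z) z :=
    (hH.1.differentiableAt (isOpen_ball.mem_nhds hz)).hasDerivAt
  have hd1 : HasDerivAt (fun w => 2 * H w - H 0) (2 * deriv H z) z :=
    (hd.const_mul 2).sub_const _
  have hd2 := (hasDerivAt_circleAverage_herglotzRieszKernel_smul hint hz).congr_of_eventuallyEq
    (f₁ := fun w => 2 * H w - H 0) (by
      filter_upwards [isOpen_ball.mem_nhds hz] with w hw using (key w hw).symm)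
  have e3 := hd1.unique hd2
  have hD : DiffContOnCl ℂ (fun ζ => (ζ * conj z ^ 2 / (1 - conj z * ζ) ^ 2) • H ζ)
      (ball 0 1) := by
    refine DiffContOnCl.smul (DifferentiableOn.diffContOnCl ?_) hH
    rw [closure_ball _ one_ne_zero]
    refine DifferentiableOn.div (by fun_prop) (by fun_prop) ?_
    intro ζ hζ
    exact pow_ne_zero _ (one_sub_conj_mul_ne_zero hz1 (by simpa using hζ))
  have e4 := DiffContOnCl.circleAverage (R := 1) (c := 0) (by simpa using hD)
  simp only [zero_mul, zero_div] at e4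
  have e5 : deriv H z =
      Real.circleAverage (fun ζ => (1 / 2 : ℂ) • ((2 * ζ / (ζ - z) ^ 2) • H ζ)) 0 1 := by
    rw [Real.circleAverage_fun_smul, ← e3]; simp
  rw [e5, ← sub_zero (Real.circleAverage _ 0 1), ← congrArg (Real.circleAverage _ 0 1 - ·) e4,
    ← Real.circleAverage_fun_sub]
  · congr 1
    ext ζ
    simp only [derivKernel, smul_eq_mul]; ring
  · exact hI1.const_fun_smul
  · refine ContinuousOn.circleIntegrable zero_le_one (hD.2.mono ?_)
    exact (sphere_subset_closedBall.trans_eq (closure_ball 0 one_ne_zero).symm)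

/-- If a function continuous on the closed disk and holomorphic inside has derivative `c` at `ζ`
along the circle, then its complex derivative has nontangential limit `c` at `ζ`. -/
theorem hasNontangentialLimit_deriv {G : ℂ → ℂ} {c : ℂ} {ζ : Circle}
    (hG : DiffContOnCl ℂ G (ball 0 1))
    (hc : ∀ ε > 0, ∃ δ > 0, ∀ w : ℂ, ‖w‖ = 1 → ‖w - ζ‖ < δ →
      ‖G w - G ζ - c * (w - ζ)‖ ≤ ε * ‖w - ζ‖) :
    HasNontangentialLimit (fun z : Disk => deriv G z) ζ c := by
  set H : ℂ → ℂ := fun w => G w - G ζ - c * (w - ζ) with hHdef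
  have hH : DiffContOnCl ℂ H (ball 0 1) :=
    (hG.sub_const _).sub (Differentiable.diffContOnCl (by fun_prop))
  have hHd : ∀ z ∈ ball (0 : ℂ) 1, deriv H z = deriv G z - c := by
    intro z hz
    have hd := (hG.1.differentiableAt (isOpen_ball.mem_nhds hz)).hasDerivAt
    have : HasDerivAt H (deriv G z - c * 1) z :=
      (hd.sub_const (G ζ)).sub (((hasDerivAt_id' z).sub_const (ζ : ℂ)).const_mul c)
    rw [this.deriv, mul_one]
  obtain ⟨M, hM⟩ : ∃ M, ∀ w ∈ sphere (0 : ℂ) 1, ‖H w‖ ≤ M :=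
    (isCompact_sphere 0 1).exists_bound_of_continuousOn
      (hH.2.mono (sphere_subset_closedBall.trans_eq (closure_ball 0 one_ne_zero).symm))
  have hM0 : 0 ≤ M := (norm_nonneg _).trans (hM 1 (by simp))
  intro a ha
  rw [Metric.tendsto_nhds]
  intro ε hε
  obtain ⟨δ, hδ, hδ'⟩ := hc (ε / (4 * (1 + a))) (by positivity)
  have hη : 0 < min (δ / 2) (ε * δ ^ 3 / (64 * (M + 1))) := by positivity
  have hnear : ∀ᶠ z : Disk in comap (fun z : Disk => (z : ℂ)) (𝓝 (ζ : ℂ)),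
      ‖(z : ℂ) - ζ‖ < min (δ / 2) (ε * δ ^ 3 / (64 * (M + 1))) := by
    have := preimage_mem_comap (m := fun z : Disk => (z : ℂ)) (Metric.ball_mem_nhds (ζ : ℂ) hη)
    filter_upwards [this] with z hz
    simpa [dist_eq_norm] using hz
  filter_upwards [mem_inf_of_left hnear, mem_inf_of_right (mem_principal_self _)] with z hz hzs
  have hz1 : ‖(z : ℂ)‖ < 1 := z.norm_lt_one
  have hzb : (z : ℂ) ∈ ball (0 : ℂ) 1 := by simpa using hz1
  have hzs' : ‖(z : ℂ) - ζ‖ < a * (1 - ‖(z : ℂ)‖) := hzs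
  obtain ⟨hz2, hz3⟩ := lt_min_iff.1 hz
  have hP := circleIntegrable_poissonKernel hzb
  -- In the Stolz region `‖w - ζ‖ ≤ (1 + a) * ‖w - z‖`, so near `ζ` the factor `‖w - z‖⁻¹` of the
  -- kernel bound is absorbed; away from `ζ` the Poisson kernel itself is small.
  have hbound : ∀ w : ℂ, ‖w‖ = 1 → ‖derivKernel z w • H w‖ ≤
      (ε / 2) * poissonKernel 0 z w + 32 * M * ‖(z : ℂ) - ζ‖ / δ ^ 3 := by
    intro w hw
    have hwz : 0 < ‖w - z‖ := norm_pos_iff.2 (sub_ne_zero_of_norm hz1 hw)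
    have hPn := poissonKernel_nonneg hz1 hw
    have hdist : 1 - ‖(z : ℂ)‖ ≤ ‖w - z‖ := by
      rw [← hw]; exact norm_sub_norm_le _ _
    have htri : ‖w - ζ‖ ≤ ‖w - z‖ + ‖(z : ℂ) - ζ‖ := by
      simpa using norm_add_le (w - z) ((z : ℂ) - ζ)
    rw [norm_smul]
    refine (mul_le_mul_of_nonneg_right (norm_derivKernel_le hz1 hw) (norm_nonneg _)).trans ?_
    by_cases hwδ : ‖w - ζ‖ < δ
    · have h1 : ‖H w‖ ≤ (ε / (4 * (1 + a))) * ((1 + a) * ‖w - z‖) := by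
        refine (hδ' w hw hwδ).trans ?_
        gcongr
        nlinarith
      have h2 : 2 * poissonKernel 0 z w / ‖w - z‖ * ‖H w‖ ≤ (ε / 2) * poissonKernel 0 z w := by
        calc _ ≤ 2 * poissonKernel 0 z w / ‖w - z‖ *
              ((ε / (4 * (1 + a))) * ((1 + a) * ‖w - z‖)) := by gcongr
          _ = _ := by field_simp; ring
      have : 0 ≤ 32 * M * ‖(z : ℂ) - ζ‖ / δ ^ 3 := by positivity
      linarith
    · have h1 : δ / 2 ≤ ‖w - z‖ := by linarith
      have h2 : 1 - ‖(z : ℂ)‖ ^ 2 ≤ 2 * ‖(z : ℂ) - ζ‖ := by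
        have : 1 - ‖(z : ℂ)‖ ≤ ‖(z : ℂ) - ζ‖ := by
          rw [norm_sub_rev, ← Circle.norm_coe ζ]; exact norm_sub_norm_le _ _
        nlinarith [norm_nonneg (z : ℂ)]
      have h3 : 2 * poissonKernel 0 z w / ‖w - z‖ * ‖H w‖ ≤ 32 * M * ‖(z : ℂ) - ζ‖ / δ ^ 3 := by
        have hHw := hM w (by simpa using hw)
        simp only [poissonKernel_def, sub_zero, hw, one_pow]
        calc _ ≤ 2 * ((2 * ‖(z : ℂ) - ζ‖) / (δ / 2) ^ 2) / (δ / 2) * M := by gcongr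
          _ = _ := by field_simp; ring
      have : 0 ≤ (ε / 2) * poissonKernel 0 z w := by positivity
      linarith
  have hI : CircleIntegrable (fun w => (ε / 2) * poissonKernel 0 z w) 0 1 := by
    simpa using hP.const_fun_smul (a := ε / 2)
  rw [dist_eq_norm, ← hHd z hzb, deriv_eq_circleAverage hH hzb]
  have hle := norm_circleAverage_le (F := fun w => derivKernel z w • H w)
    (hI.add (circleIntegrable_const (32 * M * ‖(z : ℂ) - ζ‖ / δ ^ 3) 0 1))
    (Eventually.of_forall fun θ => hbound _ (by simp))
  refine hle.trans_lt ?_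
  rw [Real.circleAverage_add hI (circleIntegrable_const _ 0 1), Real.circleAverage_const]
  have : Real.circleAverage (fun w => (ε / 2) * poissonKernel 0 z w) 0 1 = ε / 2 := by
    have := Real.circleAverage_fun_smul (a := ε / 2) (f := poissonKernel 0 (z : ℂ)) (c := 0) (R := 1)
    simp only [smul_eq_mul] at this
    rw [this, circleAverage_poissonKernel hzb, mul_one]
  rw [this]
  have : 32 * M * ‖(z : ℂ) - ζ‖ / δ ^ 3 < ε / 2 := by
    rw [div_lt_iff₀ (by positivity)]
    rw [lt_div_iff₀ (by positivity)] at hz3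
    have := norm_nonneg ((z : ℂ) - ζ)
    nlinarith
  linarith

/-! ### Nontangential limits of bounded holomorphic functions -/

theorem circleMap_eq_exp (θ : ℝ) : circleMap 0 1 θ = (Circle.exp θ : ℂ) := by
  simp [circleMap, Circle.coe_exp]

/-- Fatou's theorem: a bounded holomorphic function on the disk has nontangential limits almost
everywhere on the circle. -/
theorem ae_exists_hasNontangentialLimit {f : Disk →ᵇ ℂ} (hf : f ∈ HInfty) :
    ∀ᵐ θ : ℝ, ∃ w, HasNontangentialLimit f (Circle.exp θ) w := by
  obtain ⟨F, hF, hfF⟩ := hf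
  obtain ⟨G₀, hG₀⟩ := hF.isExactOn_ball
  have hFb : ∀ z ∈ ball (0 : ℂ) 1, ‖F z‖ ≤ ‖f‖ := by
    intro z hz
    rw [← UnitDisc.coe_mk z (by simpa using hz), ← hfF]
    exact f.norm_coe_le_norm _
  have hL : LipschitzOnWith ‖f‖₊ G₀ (ball 0 1) := by
    refine (convex_ball (0 : ℂ) 1).lipschitzOnWith_of_nnnorm_hasDerivWithin_le
      (fun z hz => (hG₀ z hz).hasDerivWithinAt) ?_
    exact fun z hz => hFb z hz
  obtain ⟨G, hG, hGG₀⟩ := hL.extend_finite_dimension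
  have hGd : ∀ z ∈ ball (0 : ℂ) 1, HasDerivAt G (F z) z := fun z hz =>
    (hG₀ z hz).congr_of_eventuallyEq
      (by filter_upwards [isOpen_ball.mem_nhds hz] with w hw using (hGG₀ hw).symm)
  have hGc : DiffContOnCl ℂ G (ball 0 1) :=
    ⟨fun z hz => (hGd z hz).differentiableAt.differentiableWithinAt, hG.continuous.continuousOn⟩
  have hfG : (f : Disk → ℂ) = fun z : Disk => deriv G z := by
    ext z
    rw [hfF, (hGd z (by simpa using z.norm_lt_one)).deriv]
  filter_upwards [(hG.comp (lipschitzWith_circleMap 0 1)).ae_differentiableAt] with θ₀ hθ₀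
  set ζ : Circle := Circle.exp θ₀ with hζ
  set D : ℂ := deriv (G ∘ circleMap 0 1) θ₀ with hD
  set c : ℂ := D / (ζ * I) with hcdef
  refine ⟨c, ?_⟩
  rw [hfG]
  refine hasNontangentialLimit_deriv hGc fun ε hε => ?_
  -- `c` is the derivative along the circle, because `circleMap 0 1` has derivative `ζ * I` at `θ₀`.
  have hk : HasDerivAt (fun θ => (G ∘ circleMap 0 1) θ - c * circleMap 0 1 θ) 0 θ₀ := by
    have h1 := hθ₀.hasDerivAt.sub ((hasDerivAt_circleMap 0 1 θ₀).const_mul c)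
    convert! h1 using 1
    rw [circleMap_eq_exp, ← hζ, hcdef, div_mul_cancel₀ _ (mul_ne_zero ζ.coe_ne_zero I_ne_zero),
      sub_self]
  have hb := hk.isLittleO.bound (c := ε / 2) (by positivity)
  obtain ⟨δ, hδ, hδ'⟩ := Metric.eventually_nhds_iff.1 hb
  refine ⟨δ / 2, by positivity, fun w hw hwζ => ?_⟩
  have hw0 : w ≠ 0 := by rintro rfl; simp at hw
  have hdiv : ‖w / ζ‖ = 1 := by rw [norm_div, hw, Circle.norm_coe, div_one]
  set t := (w / ζ).arg with ht
  have ht1 : |t| ≤ Real.pi / 2 * ‖w - ζ‖ := by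
    rw [ht, ← angle_eq_abs_arg hw0 ζ.coe_ne_zero]
    exact angle_le_mul_norm_sub hw ζ.norm_coe
  have ht2 : |t| ≤ 2 * ‖w - ζ‖ := ht1.trans (by
    gcongr; linarith [Real.pi_le_four])
  have hwt : circleMap 0 1 (θ₀ + t) = w := by
    rw [circleMap_eq_exp, Circle.exp_add, Circle.coe_mul, ← hζ, Circle.coe_exp t]
    have := norm_mul_exp_arg_mul_I (w / ζ)
    rw [hdiv, ofReal_one, one_mul] at this
    rw [this, mul_div_cancel₀ _ ζ.coe_ne_zero]
  have h3 := @hδ' (θ₀ + t) (by rw [Real.dist_eq]; simp; linarith)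
  simp only [Function.comp_apply, hwt, circleMap_eq_exp θ₀, ← hζ, smul_zero, sub_zero,
    add_sub_cancel_left, Real.norm_eq_abs] at h3
  calc _ = ‖G w - c * w - (G ζ - c * ζ)‖ := by congr 1; ring
    _ ≤ ε / 2 * |t| := h3
    _ ≤ ε / 2 * (2 * ‖w - ζ‖) := by gcongr
    _ = _ := by ring

/-! ### Radial limits and the boundary trace -/

/-- The radii `(n + 1) / (n + 2)`, increasing to `1`, along which radial limits are taken. -/
noncomputable def radius (n : ℕ) : ℝ := (n + 1) / (n + 2)

theorem radius_pos (n : ℕ) : 0 < radius n := by unfold radius; positivity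

theorem radius_lt_one (n : ℕ) : radius n < 1 := by
  unfold radius; rw [div_lt_one (by positivity)]; linarith

theorem tendsto_radius : Tendsto radius atTop (𝓝 1) := by
  have h := (tendsto_natCast_div_add_atTop (1 : ℝ)).comp (tendsto_add_atTop_nat 1)
  refine h.congr fun n => ?_
  simp [radius]; ring

theorem norm_circleMap_radius (n : ℕ) (θ : ℝ) : ‖circleMap 0 (radius n) θ‖ = radius n := by
  simp [abs_of_pos (radius_pos n)]

/-- The point `radius n * exp (iθ)` of the disk. -/
noncomputable def radialPoint (n : ℕ) (θ : ℝ) : Disk :=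
  UnitDisc.mk (circleMap 0 (radius n) θ) (by rw [norm_circleMap_radius]; exact radius_lt_one n)

theorem tendsto_radialPoint {a : ℝ} (ha : 1 < a) (θ : ℝ) :
    Tendsto (fun n => radialPoint n θ) atTop
      (comap (fun z : Disk => (z : ℂ)) (𝓝 (Circle.exp θ : ℂ)) ⊓
        𝓟 (stolzRegion a (Circle.exp θ))) := by
  have hc : ∀ n, (radialPoint n θ : ℂ) = radius n * (Circle.exp θ : ℂ) := fun n => by
    simp [radialPoint, circleMap, Circle.coe_exp]
  refine tendsto_inf.2 ⟨tendsto_comap_iff.2 ?_, tendsto_principal.2 (Eventually.of_forall ?_)⟩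
  · have h : Tendsto (fun n => (radius n : ℂ) * (Circle.exp θ : ℂ)) atTop
        (𝓝 ((1 : ℝ) * (Circle.exp θ : ℂ))) :=
      ((continuous_ofReal.tendsto 1).comp tendsto_radius).mul_const _
    rw [ofReal_one, one_mul] at h
    exact h.congr fun n => (hc n).symm
  · intro n
    have h0 := radius_lt_one n
    have h1 : ‖(radius n : ℂ) * (Circle.exp θ : ℂ) - Circle.exp θ‖ = 1 - radius n := by
      rw [← sub_one_mul, norm_mul, Circle.norm_coe, mul_one, ← ofReal_one, ← ofReal_sub,
        norm_real, Real.norm_eq_abs, abs_sub_comm, abs_of_pos (by linarith)]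
    change ‖(radialPoint n θ : ℂ) - (Circle.exp θ : ℂ)‖ < a * (1 - ‖(radialPoint n θ : ℂ)‖)
    rw [hc, h1, norm_mul, Circle.norm_coe, mul_one, norm_real,
      Real.norm_of_nonneg (radius_pos n).le]
    nlinarith

theorem hasNontangentialLimit_boundaryTrace {f : Disk → ℂ} {ζ : Circle}
    (h : ∃ w, HasNontangentialLimit f ζ w) : HasNontangentialLimit f ζ (boundaryTrace f ζ) := by
  rw [boundaryTrace, dif_pos h]
  exact h.choose_spec

theorem tendsto_boundaryTrace {f : Disk →ᵇ ℂ} (hf : f ∈ HInfty) :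
    ∀ᵐ θ : ℝ, Tendsto (fun n => f (radialPoint n θ)) atTop
      (𝓝 (boundaryTrace f (Circle.exp θ))) := by
  filter_upwards [ae_exists_hasNontangentialLimit hf] with θ hθ
  exact (hasNontangentialLimit_boundaryTrace hθ 2 one_lt_two).comp
    (tendsto_radialPoint one_lt_two θ)

theorem norm_boundaryTrace_le (f : Disk →ᵇ ℂ) (θ : ℝ) :
    ‖boundaryTrace f (Circle.exp θ)‖ ≤ ‖f‖ := by
  by_cases h : ∃ w, HasNontangentialLimit f (Circle.exp θ) w
  · exact le_of_tendsto ((hasNontangentialLimit_boundaryTrace h 2 one_lt_two).comp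
      (tendsto_radialPoint one_lt_two θ)).norm (Eventually.of_forall fun n => f.norm_coe_le_norm _)
  · rw [boundaryTrace, dif_neg h]; simp

theorem continuous_radialPoint (n : ℕ) : Continuous (radialPoint n) :=
  UnitDisc.isEmbedding_coe.continuous_iff.2 (continuous_circleMap 0 (radius n))

theorem aestronglyMeasurable_boundaryTrace {f : Disk →ᵇ ℂ} (hf : f ∈ HInfty) :
    AEStronglyMeasurable (fun θ : ℝ => boundaryTrace f (Circle.exp θ)) :=
  aestronglyMeasurable_of_tendsto_ae atTop
    (fun n => (f.continuous.comp (continuous_radialPoint n)).aestronglyMeasurable)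
    (tendsto_boundaryTrace hf)

/-! ### Fourier coefficients and the Poisson formula -/

theorem intervalIntegrable_mul_boundaryTrace {f : Disk →ᵇ ℂ} (hf : f ∈ HInfty) {K : ℝ → ℂ}
    (hK : Continuous K) :
    IntervalIntegrable (fun θ => K θ * boundaryTrace f (Circle.exp θ)) volume 0 (2 * Real.pi) := by
  refine IntervalIntegrable.mono_fun' (g := fun θ => ‖K θ‖ * ‖f‖)
    (by apply Continuous.intervalIntegrable; fun_prop)
    (hK.aestronglyMeasurable.mul (aestronglyMeasurable_boundaryTrace hf)).restrict
    (ae_of_all _ fun θ => ?_)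
  simp only [norm_mul]
  gcongr
  exact norm_boundaryTrace_le f θ

theorem tendsto_integral_mul_radial {f : Disk →ᵇ ℂ} (hf : f ∈ HInfty) {K : ℝ → ℂ}
    (hK : Continuous K) :
    Tendsto (fun n => ∫ θ in (0 : ℝ)..(2 * Real.pi), K θ * f (radialPoint n θ)) atTop
      (𝓝 (∫ θ in (0 : ℝ)..(2 * Real.pi), K θ * boundaryTrace f (Circle.exp θ))) := by
  refine intervalIntegral.tendsto_integral_filter_of_dominated_convergence
    (fun θ => ‖K θ‖ * ‖f‖) (Eventually.of_forall fun n => ?_)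
    (Eventually.of_forall fun n => ae_of_all _ fun θ _ => ?_) ?_ ?_
  · exact (hK.mul (f.continuous.comp (continuous_radialPoint n))).aestronglyMeasurable
  · rw [norm_mul]
    gcongr
    exact f.norm_coe_le_norm _
  · apply Continuous.intervalIntegrable; fun_prop
  · filter_upwards [tendsto_boundaryTrace hf] with θ hθ _ using hθ.const_mul _

theorem boundaryTrace_add {f g : Disk →ᵇ ℂ} (hf : f ∈ HInfty) (hg : g ∈ HInfty) :
    ∀ᵐ θ : ℝ, boundaryTrace (f + g) (Circle.exp θ) =
      boundaryTrace f (Circle.exp θ) + boundaryTrace g (Circle.exp θ) := by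
  filter_upwards [tendsto_boundaryTrace hf, tendsto_boundaryTrace hg,
    tendsto_boundaryTrace (HInfty.add_mem hf hg)] with θ h1 h2 h3
  exact tendsto_nhds_unique h3 (h1.add h2)

theorem boundaryTrace_smul (c : ℂ) {f : Disk →ᵇ ℂ} (hf : f ∈ HInfty) :
    ∀ᵐ θ : ℝ, boundaryTrace (c • f) (Circle.exp θ) = c * boundaryTrace f (Circle.exp θ) := by
  filter_upwards [tendsto_boundaryTrace hf, tendsto_boundaryTrace (HInfty.smul_mem c hf)]
    with θ h1 h2
  exact tendsto_nhds_unique h2 (h1.const_mul c)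

theorem continuous_conj_exp_zpow (k : ℤ) :
    Continuous fun θ : ℝ => conj (Circle.exp θ : ℂ) ^ k := by
  refine Continuous.zpow₀ (by fun_prop) k fun θ => Or.inl ?_
  simp

/-- The `k`-th Fourier coefficient of the boundary trace, as a linear functional on `H^∞`. -/
noncomputable def fourierCoefficientₗ (k : ℤ) : HInfty →ₗ[ℂ] ℂ where
  toFun f := fourierCoefficient (boundaryTrace (f : Disk →ᵇ ℂ)) k
  map_add' f g := by
    have hK := continuous_conj_exp_zpow k
    simp only [fourierCoefficient, ← mul_add]
    rw [← intervalIntegral.integral_add (intervalIntegrable_mul_boundaryTrace f.2 hK)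
      (intervalIntegrable_mul_boundaryTrace g.2 hK)]
    congr 1
    refine intervalIntegral.integral_congr_ae ?_
    filter_upwards [boundaryTrace_add f.2 g.2] with θ hθ _
    rw [← mul_add, ← hθ]
    rfl
  map_smul' c f := by
    simp only [fourierCoefficient, RingHom.id_apply, smul_eq_mul]
    rw [mul_left_comm c, ← intervalIntegral.integral_const_mul c]
    refine congrArg _ (intervalIntegral.integral_congr_ae ?_)
    filter_upwards [boundaryTrace_smul c f.2] with θ hθ _
    rw [mul_left_comm, ← hθ]
    rfl

theorem fourierCoefficient_boundaryTrace_of_neg {f : Disk →ᵇ ℂ} (hf : f ∈ HInfty) {k : ℤ}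
    (hk : k < 0) : fourierCoefficient (boundaryTrace f) k = 0 := by
  have h := tendsto_integral_mul_radial hf (continuous_conj_exp_zpow k)
  obtain ⟨m, rfl⟩ : ∃ m : ℕ, k = -m := ⟨k.natAbs, by omega⟩
  have hm : m ≠ 0 := by rintro rfl; simp at hk
  obtain ⟨F, hF, hfF⟩ := hf
  have hz : ∀ n, ∫ θ in (0 : ℝ)..(2 * Real.pi),
      conj (Circle.exp θ : ℂ) ^ (-(m : ℤ)) * f (radialPoint n θ) = 0 := by
    intro n
    have hr0 := radius_pos n
    have hr1 := radius_lt_one n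
    -- On the circle of radius `radius n`, `conj ζ ^ (-m)` is `(w / radius n) ^ m`; the mean value
    -- property at `0` then gives `0`.
    have hd : DiffContOnCl ℂ (fun w => (w / radius n) ^ m * F w) (ball 0 |radius n|) := by
      refine DifferentiableOn.diffContOnCl ?_
      rw [abs_of_pos hr0, closure_ball _ hr0.ne']
      exact DifferentiableOn.mul (by fun_prop) (hF.mono (closedBall_subset_ball hr1))
    have h0 := hd.circleAverage
    rw [Real.circleAverage_def, zero_div, zero_pow hm, zero_mul, smul_eq_zero] at h0
    have h1 := h0.resolve_left (by positivity)
    refine (intervalIntegral.integral_congr fun θ _ => ?_).trans h1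
    rw [hfF, zpow_neg, zpow_natCast, ← inv_pow, ← Circle.coe_inv_eq_conj, ← Circle.coe_inv, inv_inv]
    simp [radialPoint, circleMap, Circle.coe_exp, hr0.ne']
  simp only [hz] at h
  rw [fourierCoefficient, ← tendsto_nhds_unique tendsto_const_nhds h, mul_zero]

theorem continuous_poissonKernel_circleMap {z : ℂ} (hz : ‖z‖ < 1) :
    Continuous fun θ : ℝ => poissonKernel 0 z (circleMap 0 1 θ) := by
  simp only [poissonKernel_def, sub_zero]
  refine Continuous.div (by fun_prop) (by fun_prop) fun θ => ?_
  exact pow_ne_zero _ (norm_ne_zero_iff.2 (sub_ne_zero_of_norm hz (by simp)))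

theorem exp_arg_circleMap (θ : ℝ) : Circle.exp (circleMap 0 1 θ).arg = Circle.exp θ := by
  rw [circleMap_eq_exp, Circle.exp_arg]

/-- Poisson's formula: a function in `H^∞` is the Poisson integral of its boundary trace. -/
theorem circleAverage_poissonKernel_boundaryTrace {f : Disk →ᵇ ℂ} (hf : f ∈ HInfty) (z : Disk) :
    Real.circleAverage (fun w => poissonKernel 0 (z : ℂ) w •
      boundaryTrace f (Circle.exp w.arg)) 0 1 = f z := by
  have hz1 : ‖(z : ℂ)‖ < 1 := z.norm_lt_one
  have h := tendsto_integral_mul_radial hf (continuous_ofReal.comp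
    (continuous_poissonKernel_circleMap hz1))
  obtain ⟨F, hF, hfF⟩ := hf
  have hn : ∀ n, (2 * Real.pi)⁻¹ • ∫ θ in (0 : ℝ)..(2 * Real.pi),
      (ofReal ∘ fun θ : ℝ => poissonKernel 0 (z : ℂ) (circleMap 0 1 θ)) θ * f (radialPoint n θ)
        = F (radius n * z) := by
    intro n
    have hr0 := radius_pos n
    have hr1 := radius_lt_one n
    have hd : DiffContOnCl ℂ (fun w => F (radius n * w)) (ball 0 1) := by
      refine DifferentiableOn.diffContOnCl ?_
      rw [closure_ball _ one_ne_zero]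
      refine hF.comp (by fun_prop) fun w hw => ?_
      have hw' : ‖w‖ ≤ 1 := by simpa using hw
      rw [mem_ball_zero_iff, norm_mul, norm_real, Real.norm_of_nonneg hr0.le]
      nlinarith
    rw [← hd.circleAverage_poissonKernel_smul (w := z) (by simpa using hz1),
      Real.circleAverage_def]
    congr 1
    refine intervalIntegral.integral_congr fun θ _ => ?_
    simp [hfF, radialPoint, circleMap]
  have h2 := h.const_smul (2 * Real.pi)⁻¹
  simp only [hn] at h2
  have h3 : Tendsto (fun n => F (radius n * z)) atTop (𝓝 (F z)) := by
    refine (hF.differentiableAt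
      (isOpen_ball.mem_nhds (by simpa using hz1))).continuousAt.tendsto.comp ?_
    have : Tendsto (fun n => (radius n : ℂ) * z) atTop (𝓝 ((1 : ℝ) * (z : ℂ))) :=
      ((continuous_ofReal.tendsto 1).comp tendsto_radius).mul_const _
    simpa using this
  rw [hfF, tendsto_nhds_unique h3 h2, Real.circleAverage_def]
  congr 1
  refine intervalIntegral.integral_congr fun θ _ => ?_
  simp [exp_arg_circleMap]

/-! ### Logarithmic integrals -/

/-- The function `-log x`, truncated below at `0` and equal to `∞` for `x ≤ 0`. With values in
`[0, ∞]` it is continuous on all of `ℝ`. -/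
noncomputable def negLog (x : ℝ) : ℝ≥0∞ := (-ENNReal.log (ENNReal.ofReal x)).toENNReal

theorem continuous_negLog : Continuous negLog := by
  have := ENNReal.continuous_ofReal
  unfold negLog
  fun_prop

theorem negLog_of_pos {x : ℝ} (hx : 0 < x) : negLog x = ENNReal.ofReal (-Real.log x) := by
  rw [negLog, ENNReal.log_ofReal_of_pos hx, ← EReal.coe_neg, EReal.real_coe_toENNReal]

theorem negLog_of_nonpos {x : ℝ} (hx : x ≤ 0) : negLog x = ⊤ := by
  simp [negLog, ENNReal.ofReal_of_nonpos hx]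

theorem negLog_antitone : Antitone negLog := fun _ _ h =>
  EReal.toENNReal_le_toENNReal (EReal.neg_le_neg_iff.2 (ENNReal.log_monotone
    (ENNReal.ofReal_le_ofReal h)))

theorem negLog_mul_sq_le {c x : ℝ} (hc : 0 < c) (hx : 0 ≤ x) :
    negLog (c * x ^ 2) ≤ negLog c + 2 * negLog x := by
  rcases hx.eq_or_lt with rfl | hx
  · simp [negLog_of_nonpos le_rfl]
  · rw [negLog_of_pos (by positivity), negLog_of_pos hc, negLog_of_pos hx,
      Real.log_mul hc.ne' (by positivity), Real.log_pow, neg_add]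
    refine ENNReal.ofReal_add_le.trans ?_
    gcongr
    rw [← ENNReal.ofReal_ofNat 2, ← ENNReal.ofReal_mul (by norm_num)]
    apply ENNReal.ofReal_le_ofReal
    push_cast; linarith

theorem logIntegral_eq_bot_iff {φ : Circle → ℂ} :
    logIntegral φ = ⊥ ↔
      ∫⁻ θ in Set.Ioc (0 : ℝ) (2 * Real.pi), negLog (1 - ‖φ (Circle.exp θ)‖) = ⊤ := by
  have h : ∀ ζ, (ENNReal.log (ENNReal.ofReal (1 - ‖φ ζ‖))).toENNReal = 0 := by
    intro ζ
    refine EReal.toENNReal_of_nonpos (ENNReal.log_le_zero_iff.2 ?_)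
    rw [ENNReal.ofReal_le_one]
    linarith [norm_nonneg (φ ζ)]
  rw [logIntegral, circleIntegralEReal]
  simp only [h, lintegral_zero, EReal.coe_ennreal_zero, zero_sub, EReal.neg_eq_bot_iff,
    EReal.coe_ennreal_eq_top_iff]
  rfl

/-- By Jensen's formula the logarithmic means over the circles of radius at least `1 / 2` are bounded
below. If `F` vanishes identically this holds because `Real.log 0 = 0`. -/
theorem exists_le_circleAverage_log {F : ℂ → ℂ} (hF : DifferentiableOn ℂ F (ball 0 1)) :
    ∃ C : ℝ, ∀ n, C ≤ Real.circleAverage (Real.log ‖F ·‖) 0 (radius n) := by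
  set d : ℤ := (meromorphicOrderAt F 0).untop₀
  have hFa : AnalyticOnNhd ℂ F (ball 0 1) := hF.analyticOnNhd isOpen_ball
  refine ⟨d * Real.log (1 / 2) + Real.log ‖meromorphicTrailingCoeffAt F 0‖, fun n => ?_⟩
  have hr0 := radius_pos n
  have hr1 := radius_lt_one n
  have hr2 : 1 / 2 ≤ radius n := by
    unfold radius
    rw [div_le_div_iff₀ (by norm_num) (by positivity)]
    have : (0 : ℝ) ≤ n := n.cast_nonneg
    linarith
  have hFn : AnalyticOnNhd ℂ F (closedBall 0 |radius n|) := by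
    rw [abs_of_pos hr0]; exact hFa.mono (closedBall_subset_ball hr1)
  have hd0 : 0 ≤ d := by
    have := MeromorphicOn.AnalyticOnNhd.divisor_nonneg hFn 0
    rwa [hFn.meromorphicOn.divisor_apply (by simp)] at this
  rw [MeromorphicOn.circleAverage_log_norm hr0.ne' hFn.meromorphicOn,
    hFn.meromorphicOn.divisor_apply (by simp)]
  have h1 : 0 ≤ ∑ᶠ u, MeromorphicOn.divisor F (closedBall 0 |radius n|) u *
      Real.log (radius n * ‖0 - u‖⁻¹) := by
    refine finsum_nonneg fun u => ?_
    by_cases hu : u ∈ closedBall (0 : ℂ) |radius n|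
    · refine mul_nonneg (by exact_mod_cast MeromorphicOn.AnalyticOnNhd.divisor_nonneg hFn u) ?_
      rw [zero_sub, norm_neg, ← div_eq_mul_inv]
      rw [mem_closedBall_zero_iff, abs_of_pos hr0] at hu
      -- At `u = 0` the logarithm is `Real.log 0 = 0`.
      rcases (norm_nonneg u).eq_or_lt with h | h
      · simp [← h]
      · exact Real.log_nonneg ((one_le_div h).2 hu)
    · simp [Function.locallyFinsuppWithin.apply_eq_zero_of_notMem _ hu]
  have h2 : (d : ℝ) * Real.log (1 / 2) ≤ d * Real.log (radius n) := by
    have : (0 : ℝ) ≤ d := by exact_mod_cast hd0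
    gcongr
  linarith

theorem coe_radialPoint (n : ℕ) (θ : ℝ) : (radialPoint n θ : ℂ) = circleMap 0 (radius n) θ := rfl

/-- A nonzero function in the unit ball of `H^∞` has log-integrable boundary trace: Jensen's formula
bounds the logarithmic means on smaller circles from below, and Fatou's lemma carries the bound
to the boundary. -/
theorem lintegral_negLog_boundaryTrace_ne_top {φ : Disk →ᵇ ℂ} (hφ : φ ∈ HInfty) (hφ1 : ‖φ‖ ≤ 1)
    (hφ0 : φ ≠ 0) :
    ∫⁻ θ in Set.Ioc (0 : ℝ) (2 * Real.pi), negLog ‖boundaryTrace φ (Circle.exp θ)‖ ≠ ⊤ := by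
  have hlim := tendsto_boundaryTrace hφ
  obtain ⟨F, hF, hfF⟩ := hφ
  have hFa : AnalyticOnNhd ℂ F (ball 0 1) := hF.analyticOnNhd isOpen_ball
  obtain ⟨C, hC⟩ := exists_le_circleAverage_log hF
  obtain ⟨z₀, hz₀⟩ : ∃ z, φ z ≠ 0 := by
    by_contra! h
    exact hφ0 (by ext z; simpa using h z)
  have hcod : F ⁻¹' {0}ᶜ ∈ codiscreteWithin (ball (0 : ℂ) 1) :=
    hFa.preimage_zero_mem_codiscreteWithin (x := z₀) (by rwa [← hfF])
      (by simpa using z₀.norm_lt_one)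
      ⟨nonempty_ball.2 one_pos, (convex_ball (0 : ℂ) 1).isPreconnected⟩
  have hbd : ∀ n, ∫⁻ θ in Set.Ioc (0 : ℝ) (2 * Real.pi), negLog ‖φ (radialPoint n θ)‖ ≤
      ENNReal.ofReal (2 * Real.pi * -C) := by
    intro n
    have hr0 := radius_pos n
    have hr1 := radius_lt_one n
    -- `negLog` and `-Real.log` differ at zeros of `F`, which are discrete and so negligible.
    have hne : ∀ᵐ θ ∂(volume.restrict (Set.Ioc (0 : ℝ) (2 * Real.pi))),
        F (circleMap 0 (radius n) θ) ≠ 0 := by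
      have h1 : F ⁻¹' {0}ᶜ ∈ codiscreteWithin (sphere (0 : ℂ) |radius n|) :=
        codiscreteWithin_mono (by
          rw [abs_of_pos hr0]
          exact sphere_subset_closedBall.trans (closedBall_subset_ball hr1)) hcod
      have h2 := circleMap_preimage_codiscrete hr0.ne' h1
      exact ae_restrict_le_codiscreteWithin measurableSet_Ioc
        (codiscreteWithin_mono (Set.subset_univ _) h2)
    have hFn : AnalyticOnNhd ℂ F (closedBall 0 |radius n|) := by
      rw [abs_of_pos hr0]; exact hFa.mono (closedBall_subset_ball hr1)
    have hint : CircleIntegrable (Real.log ‖F ·‖) 0 (radius n) :=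
      MeromorphicOn.circleIntegrable_log_norm
        (fun x hx => (hFn x (sphere_subset_closedBall hx)).meromorphicAt)
    have hint' := ((intervalIntegrable_iff_integrableOn_Ioc_of_le Real.two_pi_pos.le).1 hint).neg
    have hle1 : ∀ θ, ‖F (circleMap 0 (radius n) θ)‖ ≤ 1 := fun θ => by
      rw [← coe_radialPoint, ← hfF]; exact (φ.norm_coe_le_norm _).trans hφ1
    calc ∫⁻ θ in Set.Ioc (0 : ℝ) (2 * Real.pi), negLog ‖φ (radialPoint n θ)‖
        = ∫⁻ θ in Set.Ioc (0 : ℝ) (2 * Real.pi),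
            ENNReal.ofReal (-Real.log ‖F (circleMap 0 (radius n) θ)‖) := by
          refine lintegral_congr_ae ?_
          filter_upwards [hne] with θ hθ
          rw [hfF, coe_radialPoint, negLog_of_pos (norm_pos_iff.2 hθ)]
      _ = ENNReal.ofReal (∫ θ in Set.Ioc (0 : ℝ) (2 * Real.pi),
            -Real.log ‖F (circleMap 0 (radius n) θ)‖) := by
          refine (ofReal_integral_eq_lintegral_ofReal hint' (ae_of_all _ fun θ => ?_)).symm
          exact neg_nonneg.2 (Real.log_nonpos (norm_nonneg _) (hle1 θ))
      _ ≤ _ := by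
          apply ENNReal.ofReal_le_ofReal
          rw [integral_neg, ← intervalIntegral.integral_of_le Real.two_pi_pos.le]
          have := hC n
          rw [Real.circleAverage_def, smul_eq_mul, inv_mul_eq_div, le_div_iff₀ Real.two_pi_pos]
            at this
          linarith
  refine ne_top_of_le_ne_top (b := ENNReal.ofReal (2 * Real.pi * -C)) ENNReal.ofReal_ne_top ?_
  calc _ = ∫⁻ θ in Set.Ioc (0 : ℝ) (2 * Real.pi),
        liminf (fun n => negLog ‖φ (radialPoint n θ)‖) atTop := by
        refine lintegral_congr_ae (ae_restrict_of_ae ?_)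
        filter_upwards [hlim] with θ hθ
        exact ((continuous_negLog.tendsto _).comp hθ.norm).liminf_eq.symm
    _ ≤ liminf (fun n => ∫⁻ θ in Set.Ioc (0 : ℝ) (2 * Real.pi),
          negLog ‖φ (radialPoint n θ)‖) atTop :=
        lintegral_liminf_le fun n => (continuous_negLog.comp
          (φ.continuous.comp (continuous_radialPoint n)).norm).measurable
    _ ≤ _ := liminf_le_of_le (by isBoundedDefault) fun b hb => by
        obtain ⟨n, hn⟩ := hb.exists
        exact hn.trans (hbd n)

/-! ### Divergence of the logarithmic integral implies extremality -/

theorem norm_convexCombination_sq (u v : ℂ) {a b : ℝ} (hab : a + b = 1) :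
    ‖(a : ℂ) * u + b * v‖ ^ 2 = a * ‖u‖ ^ 2 + b * ‖v‖ ^ 2 - a * b * ‖u - v‖ ^ 2 := by
  obtain rfl : b = 1 - a := by linarith
  simp only [← Complex.normSq_eq_norm_sq, Complex.normSq_apply, add_re, add_im, mul_re, mul_im,
    ofReal_re, ofReal_im, sub_re, sub_im]
  ring

theorem mem_extremePoints_of_logIntegral_eq_bot {Λ : Set ℕ} {f : Disk →ᵇ ℂ} (hf : f ∈ unitBall Λ)
    (h : logIntegral (boundaryTrace f) = ⊥) : f ∈ (unitBall Λ).extremePoints ℝ := by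
  rw [logIntegral_eq_bot_iff] at h
  refine mem_extremePoints_iff_left.2 ⟨hf, fun g hg k hk ⟨a, b, ha, hb, hab, hfab⟩ => ?_⟩
  have hgk : g - k ∈ HInfty := HInfty.sub_mem hg.1.1 hk.1.1
  by_contra hne
  have hgk0 : g - k ≠ 0 := by
    intro h0
    apply hne
    rw [← hfab, ← sub_eq_zero.1 h0, ← add_smul, hab, one_smul]
  set φ : Disk →ᵇ ℂ := (1 / 2 : ℂ) • (g - k) with hφdef
  have hφ : φ ∈ HInfty := HInfty.smul_mem _ hgk
  have hφ1 : ‖φ‖ ≤ 1 := by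
    rw [hφdef, norm_smul]
    have h1 := norm_sub_le g k
    have h2 := hg.2
    have h3 := hk.2
    norm_num
    linarith
  have hφ0 : φ ≠ 0 := smul_ne_zero (by norm_num) hgk0
  have hfin := lintegral_negLog_boundaryTrace_ne_top hφ hφ1 hφ0
  have hpt : ∀ᵐ θ : ℝ, 2 * a * b * ‖boundaryTrace φ (Circle.exp θ)‖ ^ 2 ≤
      1 - ‖boundaryTrace f (Circle.exp θ)‖ := by
    filter_upwards [tendsto_boundaryTrace hf.1.1, tendsto_boundaryTrace hφ] with θ h1 h2
    have key : ∀ z, 4 * a * b * ‖φ z‖ ^ 2 ≤ 1 - ‖f z‖ ^ 2 := by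
      intro z
      have hgz : ‖g z‖ ≤ 1 := (g.norm_coe_le_norm z).trans hg.2
      have hkz : ‖k z‖ ≤ 1 := (k.norm_coe_le_norm z).trans hk.2
      have hfz : f z = a * g z + b * k z := by rw [← hfab]; simp
      have hφz : ‖φ z‖ = ‖g z - k z‖ / 2 := by simp [hφdef]; ring
      rw [hfz, hφz, norm_convexCombination_sq _ _ hab]
      have h3 : ‖g z‖ ^ 2 ≤ 1 := pow_le_one₀ (norm_nonneg _) hgz
      have h4 : ‖k z‖ ^ 2 ≤ 1 := pow_le_one₀ (norm_nonneg _) hkz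
      nlinarith
    have hl := le_of_tendsto_of_tendsto' ((h2.norm.pow 2).const_mul (4 * a * b))
      ((h1.norm.pow 2).const_sub 1) fun n => key _
    have hf1 : ‖boundaryTrace f (Circle.exp θ)‖ ≤ 1 := (norm_boundaryTrace_le f θ).trans hf.2
    nlinarith [norm_nonneg (boundaryTrace f (Circle.exp θ))]
  have hle : ∫⁻ θ in Set.Ioc (0 : ℝ) (2 * Real.pi),
      negLog (1 - ‖boundaryTrace f (Circle.exp θ)‖) ≤
      ∫⁻ θ in Set.Ioc (0 : ℝ) (2 * Real.pi),
        (negLog (2 * a * b) + 2 * negLog ‖boundaryTrace φ (Circle.exp θ)‖) := by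
    refine lintegral_mono_ae (ae_restrict_of_ae ?_)
    filter_upwards [hpt] with θ hθ
    exact (negLog_antitone hθ).trans (negLog_mul_sq_le (by positivity) (norm_nonneg _))
  rw [h, top_le_iff, lintegral_add_left measurable_const, lintegral_const_mul' _ _ (by norm_num),
    lintegral_const, negLog_of_pos (by positivity)] at hle
  refine absurd hle (ENNReal.add_ne_top.2 ⟨ENNReal.mul_ne_top
    ENNReal.ofReal_ne_top (measure_ne_top _ _),
    ENNReal.mul_ne_top (by norm_num) hfin⟩)

/-! ### The outer function -/

/-- If `log (1 - |f*|)` is integrable, the outer function `g` with boundary modulus `1 - |f*|`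
satisfies `|f| + |g| ≤ 1` on the disk: `|f|` is at most the Poisson integral of `|f*|`, and by
Jensen's inequality `|g|` is at most that of `1 - |f*|`. -/
theorem exists_outer {f : Disk →ᵇ ℂ} (hf : f ∈ HInfty) (hf1 : ‖f‖ ≤ 1)
    (h : ∫⁻ θ in Set.Ioc (0 : ℝ) (2 * Real.pi),
      negLog (1 - ‖boundaryTrace f (Circle.exp θ)‖) ≠ ⊤) :
    ∃ g : ℂ → ℂ, DifferentiableOn ℂ g (ball 0 1) ∧ (∀ z, g z ≠ 0) ∧
      ∀ z : Disk, ‖f z‖ + ‖g z‖ ≤ 1 := by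
  have hm := aestronglyMeasurable_boundaryTrace hf
  have hle : ∀ θ : ℝ, ‖boundaryTrace f (Circle.exp θ)‖ ≤ 1 := fun θ =>
    (norm_boundaryTrace_le f θ).trans hf1
  set u : ℂ → ℝ := fun w => Real.log (1 - ‖boundaryTrace f (Circle.exp w.arg)‖) with hu
  have huθ : ∀ θ, u (circleMap 0 1 θ) = Real.log (1 - ‖boundaryTrace f (Circle.exp θ)‖) :=
    fun θ => by simp only [hu, exp_arg_circleMap]
  have hum : AEStronglyMeasurable (fun θ => u (circleMap 0 1 θ)) := by
    simp only [huθ]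
    exact (Real.measurable_log.comp_aemeasurable
      ((hm.norm.aemeasurable).const_sub 1)).aestronglyMeasurable
  have hui : CircleIntegrable u 0 1 := by
    rw [CircleIntegrable, intervalIntegrable_iff_integrableOn_Ioc_of_le Real.two_pi_pos.le]
    refine ⟨hum.restrict, lt_of_le_of_lt (lintegral_mono fun θ => ?_) h.lt_top⟩
    simp only [huθ]
    rcases (sub_nonneg.2 (hle θ)).eq_or_lt with h0 | h0
    · rw [negLog_of_nonpos h0.symm.le]; exact le_top
    · rw [negLog_of_pos h0, Real.enorm_eq_ofReal_abs, abs_of_nonpos]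
      exact Real.log_nonpos h0.le (by linarith [norm_nonneg (boundaryTrace f (Circle.exp θ))])
  have hpos : ∀ᵐ θ ∂(volume.restrict (Set.Ioc (0 : ℝ) (2 * Real.pi))),
      0 < 1 - ‖boundaryTrace f (Circle.exp θ)‖ := by
    filter_upwards [ae_lt_top' (continuous_negLog.measurable.comp_aemeasurable
      ((hm.norm.aemeasurable).const_sub 1)).restrict h] with θ hθ
    by_contra hn
    rw [Function.comp_apply, negLog_of_nonpos (not_lt.1 hn)] at hθ
    exact lt_irrefl _ hθ
  have huc : CircleIntegrable (fun w => (u w : ℂ)) 0 1 := by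
    rw [CircleIntegrable, intervalIntegrable_iff] at hui ⊢
    exact hui.ofReal
  refine ⟨fun z => exp (Real.circleAverage (fun ζ => herglotzRieszKernel 0 z ζ • (u ζ : ℂ)) 0 1),
    (differentiableOn_circleAverage_herglotzRieszKernel_smul huc).cexp, fun z => exp_ne_zero _,
    fun z => ?_⟩
  have hz1 : ‖(z : ℂ)‖ < 1 := z.norm_lt_one
  have hz : (z : ℂ) ∈ ball (0 : ℂ) 1 := by simpa using hz1
  rw [norm_exp, re_circleAverage_herglotzRieszKernel_smul hui hz,
    ← poissonKernel_eq_re_herglotzRieszKernel]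
  set m := Real.circleAverage (poissonKernel 0 (z : ℂ) • u) 0 1 with hmdef
  have hP := circleIntegrable_poissonKernel hz
  have hPu : CircleIntegrable (poissonKernel 0 (z : ℂ) • u) 0 1 :=
    IntervalIntegrable.continuousOn_mul hui
      (continuous_poissonKernel_circleMap hz1).continuousOn
  -- The tangent line bound `exp u ≥ exp m * (1 + u - m)` gives Jensen's inequality after averaging.
  have hb : CircleIntegrable (fun w => (1 - Real.exp m * (1 - m)) • poissonKernel 0 (z : ℂ) w -
      Real.exp m • (poissonKernel 0 (z : ℂ) • u) w) 0 1 :=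
    hP.const_fun_smul.sub hPu.const_fun_smul
  have hpt : ∀ᵐ θ ∂(volume.restrict (Set.Ioc (0 : ℝ) (2 * Real.pi))),
      ‖poissonKernel 0 (z : ℂ) (circleMap 0 1 θ) •
        boundaryTrace f (Circle.exp (circleMap 0 1 θ).arg)‖ ≤
      (1 - Real.exp m * (1 - m)) • poissonKernel 0 (z : ℂ) (circleMap 0 1 θ) -
      Real.exp m • (poissonKernel 0 (z : ℂ) • u) (circleMap 0 1 θ) := by
    filter_upwards [hpos] with θ hθ
    have hPn := poissonKernel_nonneg hz1 (w := circleMap 0 1 θ) (by simp)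
    have h1 : ‖boundaryTrace f (Circle.exp θ)‖ = 1 - Real.exp (u (circleMap 0 1 θ)) := by
      rw [huθ, Real.exp_log hθ]; ring
    have h2 : Real.exp m * (1 + u (circleMap 0 1 θ) - m) ≤ Real.exp (u (circleMap 0 1 θ)) := by
      have := Real.add_one_le_exp (u (circleMap 0 1 θ) - m)
      calc _ ≤ Real.exp m * Real.exp (u (circleMap 0 1 θ) - m) := by gcongr; linarith
        _ = _ := by rw [← Real.exp_add]; congr 1; ring
    rw [norm_smul, Real.norm_of_nonneg hPn, exp_arg_circleMap, h1]
    simp only [smul_eq_mul, Pi.smul_apply']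
    nlinarith
  have hfle := norm_circleAverage_le (F := fun w => poissonKernel 0 (z : ℂ) w •
    boundaryTrace f (Circle.exp w.arg)) hb hpt
  rw [circleAverage_poissonKernel_boundaryTrace hf z, Real.circleAverage_fun_sub
    hP.const_fun_smul hPu.const_fun_smul, Real.circleAverage_fun_smul, Real.circleAverage_fun_smul,
    circleAverage_poissonKernel hz, ← hmdef, smul_eq_mul, smul_eq_mul] at hfle
  linarith

/-! ### Extremality implies divergence of the logarithmic integral -/

/-- The element of `H^∞` given by a bounded holomorphic function on the disk. -/
noncomputable def HInfty.mk (F : ℂ → ℂ) (hF : DifferentiableOn ℂ F (ball 0 1))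
    (hb : ∃ C, ∀ z ∈ ball (0 : ℂ) 1, ‖F z‖ ≤ C) : HInfty :=
  ⟨BoundedContinuousFunction.ofNormedAddCommGroup (fun z : Disk => F z)
    (hF.continuousOn.comp_continuous UnitDisc.continuous_coe
      fun z => by simpa using z.norm_lt_one) hb.choose
    fun z => hb.choose_spec z (by simpa using z.norm_lt_one), F, hF, fun _ => rfl⟩

theorem exists_bound_eval (p : Polynomial ℂ) :
    ∃ M > 0, ∀ z ∈ ball (0 : ℂ) 1, ‖p.eval z‖ ≤ M := by
  obtain ⟨M, hM⟩ := (isCompact_closedBall (0 : ℂ) 1).exists_bound_of_continuousOn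
    p.continuous.continuousOn
  exact ⟨max M 1, by positivity, fun z hz => (hM z (ball_subset_closedBall hz)).trans
    (le_max_left _ _)⟩

/-- The linear map `p ↦ g * p` from polynomials to `H^∞`, for a fixed holomorphic function `g` bounded
by `1` on the disk. -/
noncomputable def mulPolynomial (g : ℂ → ℂ) (hg : DifferentiableOn ℂ g (ball 0 1))
    (hg1 : ∀ z ∈ ball (0 : ℂ) 1, ‖g z‖ ≤ 1) : Polynomial ℂ →ₗ[ℂ] HInfty where
  toFun p := HInfty.mk (fun z => g z * p.eval z) (hg.mul p.differentiable.differentiableOn) (by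
    obtain ⟨M, hM0, hM⟩ := exists_bound_eval p
    refine ⟨M, fun z hz => ?_⟩
    rw [norm_mul]
    calc _ ≤ 1 * M := mul_le_mul (hg1 z hz) (hM z hz) (norm_nonneg _) zero_le_one
      _ = M := one_mul M)
  map_add' p q := by
    ext z
    change g z * (p + q).eval (z : ℂ) = g z * p.eval (z : ℂ) + g z * q.eval (z : ℂ)
    rw [Polynomial.eval_add, mul_add]
  map_smul' c p := by
    ext z
    change g z * (c • p).eval (z : ℂ) = c * (g z * p.eval (z : ℂ))
    rw [Polynomial.eval_smul, smul_eq_mul, mul_left_comm]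

theorem mulPolynomial_apply {g : ℂ → ℂ} (hg : DifferentiableOn ℂ g (ball 0 1))
    (hg1 : ∀ z ∈ ball (0 : ℂ) 1, ‖g z‖ ≤ 1) (p : Polynomial ℂ) (z : Disk) :
    (mulPolynomial g hg hg1 p : Disk →ᵇ ℂ) z = g z * p.eval (z : ℂ) := rfl

theorem mulPolynomial_ne_zero {g : ℂ → ℂ} (hg : DifferentiableOn ℂ g (ball 0 1))
    (hg1 : ∀ z ∈ ball (0 : ℂ) 1, ‖g z‖ ≤ 1) (hg0 : ∀ z, g z ≠ 0) {p : Polynomial ℂ} (hp : p ≠ 0) :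
    mulPolynomial g hg hg1 p ≠ 0 := by
  intro h
  apply hp
  refine Polynomial.eq_zero_of_infinite_isRoot p (Set.Infinite.mono (s := ball (0 : ℂ) 1) ?_ ?_)
  · intro z hz
    have h1 := mulPolynomial_apply hg hg1 p (UnitDisc.mk z (by simpa using hz))
    rw [h] at h1
    exact (mul_eq_zero.1 h1.symm).resolve_left (hg0 _)
  · exact infinite_of_mem_nhds 0 (ball_mem_nhds 0 one_pos)

/-- Finitely many coefficient conditions can be met by `g * p` with `p` a nonzero polynomial of
degree at most their number. -/
theorem exists_mulPolynomial_coefficients_eq_zero (s : Finset ℕ) {g : ℂ → ℂ}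
    (hg : DifferentiableOn ℂ g (ball 0 1)) (hg1 : ∀ z ∈ ball (0 : ℂ) 1, ‖g z‖ ≤ 1) :
    ∃ p : Polynomial ℂ, p ≠ 0 ∧ ∀ n ∈ s, fourierCoefficientₗ n (mulPolynomial g hg hg1 p) = 0 := by
  let T : Polynomial.degreeLT ℂ (s.card + 1) →ₗ[ℂ] (s → ℂ) := LinearMap.pi fun n =>
    fourierCoefficientₗ (n : ℕ) ∘ₗ mulPolynomial g hg hg1 ∘ₗ Submodule.subtype _
  have hfin := (Polynomial.degreeLTEquiv ℂ (s.card + 1)).symm.finiteDimensional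
  have hT : LinearMap.ker T ≠ ⊥ := by
    apply LinearMap.ker_ne_bot_of_finrank_lt
    rw [(Polynomial.degreeLTEquiv ℂ (s.card + 1)).finrank_eq]
    simp
  obtain ⟨p, hp, hp0⟩ := Submodule.exists_mem_ne_zero_of_ne_bot hT
  refine ⟨p, by simpa using hp0, fun n hn => ?_⟩
  exact congrFun (LinearMap.mem_ker.1 hp) ⟨n, hn⟩

theorem mem_HInftyOf_iff {Λ : Set ℕ} {f : Disk →ᵇ ℂ} :
    f ∈ HInftyOf Λ ↔ ∃ hf : f ∈ HInfty, ∀ n ∉ Λ, fourierCoefficientₗ (n : ℕ) ⟨f, hf⟩ = 0 := by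
  constructor
  · rintro ⟨hf, hs⟩
    refine ⟨hf, fun n hn => ?_⟩
    by_contra hne
    obtain ⟨m, hm, hmn⟩ := hs hne
    exact hn (Nat.cast_injective hmn ▸ hm)
  · rintro ⟨hf, hs⟩
    refine ⟨hf, fun k hk => ?_⟩
    obtain ⟨n, rfl⟩ | hneg : (∃ n : ℕ, k = n) ∨ k < 0 := by
      rcases lt_or_ge k 0 with h | h
      · exact Or.inr h
      · exact Or.inl ⟨k.toNat, (Int.toNat_of_nonneg h).symm⟩
    · by_contra hn
      exact hk (hs n fun h => hn ⟨n, h, rfl⟩)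
    · exact absurd (fourierCoefficient_boundaryTrace_of_neg hf hneg) hk

theorem logIntegral_eq_bot_of_mem_extremePoints {Λ : Set ℕ} (hΛ : Λᶜ.Finite) {f : Disk →ᵇ ℂ}
    (hf : f ∈ (unitBall Λ).extremePoints ℝ) : logIntegral (boundaryTrace f) = ⊥ := by
  obtain ⟨⟨hfΛ, hf1⟩, hext⟩ := mem_extremePoints_iff_left.1 hf
  obtain ⟨hfH, hfc⟩ := mem_HInftyOf_iff.1 hfΛ
  rw [logIntegral_eq_bot_iff]
  by_contra hfin
  obtain ⟨g, hg, hg0, hfg⟩ := exists_outer hfH hf1 hfin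
  have hg1 : ∀ z ∈ ball (0 : ℂ) 1, ‖g z‖ ≤ 1 := by
    intro z hz
    have := hfg (UnitDisc.mk z (by simpa using hz))
    rw [UnitDisc.coe_mk] at this
    linarith [norm_nonneg (f (UnitDisc.mk z (by simpa using hz)))]
  obtain ⟨p, hp0, hp⟩ := exists_mulPolynomial_coefficients_eq_zero hΛ.toFinset hg hg1
  obtain ⟨M, hM0, hM⟩ := exists_bound_eval p
  set φ : HInfty := (M⁻¹ : ℂ) • mulPolynomial g hg hg1 p with hφ
  have hφ0 : φ ≠ 0 := smul_ne_zero (by simpa using hM0.ne') (mulPolynomial_ne_zero hg hg1 hg0 hp0)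
  have hφz : ∀ z : Disk, ‖(φ : Disk →ᵇ ℂ) z‖ ≤ ‖g z‖ := by
    intro z
    change ‖(M⁻¹ : ℂ) * (g z * p.eval (z : ℂ))‖ ≤ _
    have h1 := hM z (by simpa using z.norm_lt_one)
    rw [norm_mul, norm_mul, norm_inv, norm_real, Real.norm_of_nonneg hM0.le,
      inv_mul_le_iff₀ hM0, mul_comm]
    gcongr
  have hφc : ∀ n ∉ Λ, fourierCoefficientₗ (n : ℕ) φ = 0 := by
    intro n hn
    rw [hφ, map_smul, hp n (by simpa using hn), smul_zero]
  have hmem : ∀ ψ : HInfty, (∀ n ∉ Λ, fourierCoefficientₗ (n : ℕ) ψ = 0) →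
      (∀ z : Disk, ‖(ψ : Disk →ᵇ ℂ) z‖ ≤ ‖g z‖) → f + ψ ∈ unitBall Λ := by
    intro ψ hψc hψz
    refine ⟨mem_HInftyOf_iff.2 ⟨HInfty.add_mem hfH ψ.2, fun n hn => ?_⟩, ?_⟩
    · have := map_add (fourierCoefficientₗ (n : ℕ)) ⟨f, hfH⟩ ψ
      rw [hfc n hn, hψc n hn, add_zero] at this
      exact this
    · refine (BoundedContinuousFunction.norm_le zero_le_one).2 fun z => ?_
      exact (norm_add_le _ _).trans ((add_le_add le_rfl (hψz z)).trans (hfg z))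
  have h1 := hmem φ hφc hφz
  have h2 := hmem (-φ) (fun n hn => by rw [map_neg, hφc n hn, neg_zero])
    (fun z => by simpa using hφz z)
  have h3 := hext _ h1 _ h2 ⟨1 / 2, 1 / 2, by norm_num, by norm_num, by norm_num, by
    rw [← smul_add, Submodule.coe_neg, add_add_add_comm, add_neg_cancel, add_zero, ← two_smul ℝ f,
      smul_smul]
    norm_num⟩
  exact hφ0 (Subtype.ext (by simpa using h3))

end HardySpectrum

theorem theorem2p1 (Λ : Set ℕ) (hΛ : Λᶜ.Finite)
    (f : HardySpectrum.Disk →ᵇ ℂ) (hf : f ∈ HardySpectrum.HInftyOf Λ) (hnorm : ‖f‖ = 1) :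
    f ∈ (HardySpectrum.unitBall Λ).extremePoints ℝ ↔
      HardySpectrum.logIntegral (HardySpectrum.boundaryTrace f) = ⊥ :=
  ⟨HardySpectrum.logIntegral_eq_bot_of_mem_extremePoints hΛ,
    HardySpectrum.mem_extremePoints_of_logIntegral_eq_bot ⟨hf, hnorm.le⟩⟩
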